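/- Let $p$ be a prime, and let $\delta=1$ if $p>2$ and $\delta=2$ if $p=2$. Let $f,u\in\mathbb{Z}_p[[x]]$ be power series with $f(0)=u(0)=0$ and $f'(0),u'(0)\neq 0$, where $f$ is not invertible under composition, $u$ is invertible and of infinite order under composition, and $f\circ u=u\circ f$. Suppose that the pair is minimal, that is, the first coefficient of $f$ not divisible by $p$ is that of $x^p$, $v_p(f'(0))=1$, and $v_p(u'(0)-1)=\delta$. Let $\mathfrak{m}^{\mathrm{alg}}$ be the maximal ideal of the integral closure of $\mathbb{Z}_p$ in an algebraic closure of $\mathbb{Q}_p$, let $g^{\circ n}$ denote the $n$-fold iterate of $g$ under composition, and for $n\geq 0$ put $$\Lambda_f(n)=\{\pi\in\mathfrak{m}^{\mathrm{alg}} : f^{\circ n}(\pi)=0\},\qquad \Lambda_u(n)=\{\pi\in\mathfrak{m}^{\mathrm{alg}} : u^{\circ p^n}(\pi)=\pi\},\qquad \Omega_f(n+1)=\Lambda_f(n+1)\setminus\Lambda_f(n).$$ Then for every integer $n\geq\delta$ the following hold. 1. If $\pi\in\Omega_f(n+1)$ and $i,j\geq 0$ are integers, then $u^{\circ i}(\pi)=u^{\circ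 j}(\pi)$ if and only if $p^{\,n-\delta+1}$ divides $j-i$. 2. $\Lambda_f(n)=\Lambda_u(n-\delta)$. -/

import Mathlib

namespace PadicDyn

noncomputable section

section Series

variable {R : Type*} [CommRing R]

/-- The composite `g ∘ h`, that is `g(h(x))`, of two power series (used only for `h(0) = 0`). -/
def comp (g h : PowerSeries R) : PowerSeries R := PowerSeries.subst h g

/-- The `n`-fold iterate of `g` under composition, starting from the series `x` for `n = 0`. -/
def iter (g : PowerSeries R) : ℕ → PowerSeries R
  | 0 => PowerSeries.X
  | n + 1 => comp g (iter g n)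

/-- Series with `g(0) = 0` and `g'(0) ≠ 0`. -/
def S₀ (R : Type*) [CommRing R] : Set (PowerSeries R) :=
  {g | PowerSeries.constantCoeff g = 0 ∧ PowerSeries.coeff 1 g ≠ 0}

/-- Series in `S₀ R` that are invertible under composition. -/
def G₀ (R : Type*) [CommRing R] : Set (PowerSeries R) :=
  {g | g ∈ S₀ R ∧ IsUnit (PowerSeries.coeff 1 g)}

/-- Torsion under composition. -/
def IsTorsion (g : PowerSeries R) : Prop := ∃ n : ℕ, 0 < n ∧ iter g n = PowerSeries.X

/-- A commuting pair: `f` is noninvertible, `u` is invertible and nontorsion, `f ∘ u = u ∘ f`. -/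
structure IsCommutingPair (f u : PowerSeries R) : Prop where
  f_mem : f ∈ S₀ R
  f_noninvertible : f ∉ G₀ R
  u_invertible : u ∈ G₀ R
  u_nontorsion : ¬ IsTorsion u
  commute : comp f u = comp u f

/-- The Weierstrass degree: the order of vanishing of the reduction modulo the maximal ideal. -/
def wideg [IsLocalRing R] (g : PowerSeries R) : ℕ∞ :=
  (PowerSeries.map (IsLocalRing.residue R) g).order

end Series

/-- `δ = 1` if `p > 2` and `δ = 2` if `p = 2`. -/
def delta (p : ℕ) : ℕ := if p = 2 then 2 else 1

variable {p : ℕ} [Fact p.Prime]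

/-- Minimal commuting pairs over `ℤ_p`. As the prescribed valuations are positive, the convention
`PadicInt.valuation 0 = 0` plays no role. -/
structure IsMinimalCommutingPair (f u : PowerSeries ℤ_[p]) : Prop
    extends IsCommutingPair f u where
  wideg_eq : wideg f = (p : ℕ∞)
  valuation_f : (PowerSeries.coeff 1 f).valuation = 1
  valuation_u : (PowerSeries.coeff 1 u - 1).valuation = delta p

/-- The maximal ideal of the integral closure of `ℤ_p` in the algebraic closure of `ℚ_p`, as a set:
the open unit disc for the unique extension of the `p`-adic absolute value. -/
def mAlg (p : ℕ) [Fact p.Prime] : Set (PadicAlgCl p) := {x | ‖x‖ < 1}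

/-- The value `g(x)` of a series over `ℤ_p`. For `x` in `mAlg p` the sum converges, because the
finite extension `ℚ_p(x)` is complete. -/
def eval (g : PowerSeries ℤ_[p]) (x : PadicAlgCl p) : PadicAlgCl p :=
  ∑' k : ℕ, algebraMap ℚ_[p] (PadicAlgCl p) ((PowerSeries.coeff k g : ℤ_[p]) : ℚ_[p]) * x ^ k

/-- `Λ_f(n)` for noninvertible `f`: the roots of the `n`-fold iterate of `f`. -/
def rootSet (f : PowerSeries ℤ_[p]) (n : ℕ) : Set (PadicAlgCl p) :=
  {x | x ∈ mAlg p ∧ eval (iter f n) x = 0}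

/-- `Λ_u(n)` for invertible `u`: the fixed points of the `p ^ n`-fold iterate of `u`. -/
def fixedSet (u : PowerSeries ℤ_[p]) (n : ℕ) : Set (PadicAlgCl p) :=
  {x | x ∈ mAlg p ∧ eval (iter u (p ^ n)) x = x}

/-- `Ω_f(n) = Λ_f(n) \ Λ_f(n - 1)`, with `Λ_f(-1)` empty. -/
def newRootSet (f : PowerSeries ℤ_[p]) : ℕ → Set (PadicAlgCl p)
  | 0 => rootSet f 0
  | n + 1 => rootSet f (n + 1) \ rootSet f n

end

end PadicDyn

namespace PadicDyn

open PowerSeries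

variable {p : ℕ} [Fact p.Prime]

/-! For every `d ≥ 1` the series `u^d - X` is a unit times the iterate `f^m`, where `m = δ + v_p(d)`
(powers denote iterates). So the points fixed by `u^d` are the roots of `f^m`, and both claims
follow by counting valuations.

To obtain the factorization, take the largest `M` with `f^M ∣ u^d - X` and let `w` be the quotient.
Each ratio `f^(m+1) / f^m` is an Eisenstein series, with constant term `f'(0)` of valuation 1; hence
it is irreducible and the roots of every `f^m` are simple. A zero of `w` is fixed by `u^d`, so its
`f`-orbit consists of fixed points tending to `0`; as `0` is an isolated fixed point, the orbit
reaches `0`. If the zero is a root of `f^M`, it is a double zero of `u^d - X`, which differentiating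
`f^m ∘ u^d = u^d ∘ f^m` forbids. Otherwise irreducibility makes the next ratio divide `w`, against
maximality. So `w` has no zeros and, by Weierstrass preparation, is `p^c` times a unit.

Finally `c = 0`: the same dynamics show that `f'` has no zeros, so `p ∣ f'`, and then a congruence
modulo `p^(c+1)` excludes `c ≥ 1`. Comparing linear coefficients gives `M = δ + v_p(d)`. -/

/-! ### Evaluation of integral power series on the open unit disc -/

theorem algebraMap_padicInt_eq (a : ℤ_[p]) :
    algebraMap ℚ_[p] (PadicAlgCl p) (a : ℚ_[p]) = algebraMap ℤ_[p] (PadicAlgCl p) a :=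
  (IsScalarTower.algebraMap_apply ℤ_[p] ℚ_[p] (PadicAlgCl p) a).symm

theorem norm_algebraMap_padicInt (a : ℤ_[p]) :
    ‖algebraMap ℤ_[p] (PadicAlgCl p) a‖ = ‖a‖ := by
  rw [← algebraMap_padicInt_eq, norm_algebraMap', PadicInt.norm_def]

theorem algebraMap_padicInt_injective :
    Function.Injective (algebraMap ℤ_[p] (PadicAlgCl p)) := by
  rw [injective_iff_map_eq_zero]
  intro a ha
  rw [← norm_eq_zero, ← norm_algebraMap_padicInt, ha, norm_zero]

/-- An absolutely summable family in a finite extension of `ℚ_p` is summable. -/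
theorem summable_of_mem_finiteDimensional {ι : Type*}
    (L : IntermediateField ℚ_[p] (PadicAlgCl p)) [FiniteDimensional ℚ_[p] L]
    {F : ι → PadicAlgCl p} (hF : ∀ i, F i ∈ L) (hs : Summable fun i => ‖F i‖) : Summable F := by
  have : CompleteSpace L := FiniteDimensional.complete ℚ_[p] L
  have h : Summable fun i => (⟨F i, hF i⟩ : L) := Summable.of_norm hs
  exact h.map L.val continuous_subtype_val

theorem norm_term_le (a : ℤ_[p]) (x : PadicAlgCl p) (k : ℕ) :
    ‖algebraMap ℤ_[p] (PadicAlgCl p) a * x ^ k‖ ≤ ‖x‖ ^ k := by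
  rw [norm_mul, norm_pow, norm_algebraMap_padicInt]
  exact mul_le_of_le_one_left (by positivity) a.norm_le_one

theorem term_mem_adjoin (a : ℤ_[p]) (x : PadicAlgCl p) (k : ℕ) :
    algebraMap ℤ_[p] (PadicAlgCl p) a * x ^ k ∈ IntermediateField.adjoin ℚ_[p] {x} := by
  rw [← algebraMap_padicInt_eq]
  exact mul_mem (IntermediateField.algebraMap_mem _ _)
    (pow_mem (IntermediateField.mem_adjoin_simple_self _ _) _)

instance finiteDimensional_adjoin (x : PadicAlgCl p) :
    FiniteDimensional ℚ_[p] (IntermediateField.adjoin ℚ_[p] {x}) :=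
  IntermediateField.adjoin.finiteDimensional (Algebra.IsIntegral.isIntegral x)

theorem summable_norm_term (g : PowerSeries ℤ_[p]) {x : PadicAlgCl p} (hx : ‖x‖ < 1) :
    Summable fun k => ‖algebraMap ℤ_[p] (PadicAlgCl p) (coeff k g) * x ^ k‖ :=
  (summable_geometric_of_lt_one (norm_nonneg x) hx).of_nonneg_of_le (fun _ => norm_nonneg _)
    fun k => norm_term_le _ x k

theorem summable_term (g : PowerSeries ℤ_[p]) {x : PadicAlgCl p} (hx : ‖x‖ < 1) :
    Summable fun k => algebraMap ℤ_[p] (PadicAlgCl p) (coeff k g) * x ^ k :=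
  summable_of_mem_finiteDimensional (IntermediateField.adjoin ℚ_[p] {x})
    (fun k => term_mem_adjoin _ x k) (summable_norm_term g hx)

theorem eval_eq_tsum (g : PowerSeries ℤ_[p]) (x : PadicAlgCl p) :
    eval g x = ∑' k, algebraMap ℤ_[p] (PadicAlgCl p) (coeff k g) * x ^ k := by
  simp only [eval, algebraMap_padicInt_eq]

theorem eval_mul (g h : PowerSeries ℤ_[p]) {x : PadicAlgCl p} (hx : ‖x‖ < 1) :
    eval (g * h) x = eval g x * eval h x := by
  simp only [eval_eq_tsum]
  rw [(summable_term g hx).tsum_mul_tsum_eq_tsum_sum_antidiagonal (summable_term h hx)]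
  · refine tsum_congr fun n => ?_
    rw [coeff_mul, map_sum, Finset.sum_mul]
    refine Finset.sum_congr rfl fun kl hkl => ?_
    rw [← Finset.HasAntidiagonal.mem_antidiagonal.mp hkl, map_mul, pow_add]
    ring
  · have hn := Summable.mul_norm (summable_norm_term g hx) (summable_norm_term h hx)
    exact summable_of_mem_finiteDimensional (IntermediateField.adjoin ℚ_[p] {x})
      (fun i => mul_mem (term_mem_adjoin _ x _) (term_mem_adjoin _ x _)) hn

theorem eval_add (g h : PowerSeries ℤ_[p]) {x : PadicAlgCl p} (hx : ‖x‖ < 1) :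
    eval (g + h) x = eval g x + eval h x := by
  simp only [eval_eq_tsum]
  rw [← (summable_term g hx).tsum_add (summable_term h hx)]
  exact tsum_congr fun n => by rw [map_add, map_add, add_mul]

theorem eval_monomial (k : ℕ) (a : ℤ_[p]) (x : PadicAlgCl p) :
    eval (monomial k a) x = algebraMap ℤ_[p] (PadicAlgCl p) a * x ^ k := by
  rw [eval_eq_tsum, tsum_eq_single k]
  · rw [coeff_monomial_same]
  · intro j hj
    rw [coeff_monomial, if_neg hj, map_zero, zero_mul]

theorem eval_C (a : ℤ_[p]) (x : PadicAlgCl p) :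
    eval (C a) x = algebraMap ℤ_[p] (PadicAlgCl p) a := by
  simpa using eval_monomial 0 a x

theorem eval_X (x : PadicAlgCl p) : eval (X : PowerSeries ℤ_[p]) x = x := by
  simpa [X_eq] using eval_monomial 1 (1 : ℤ_[p]) x

/-- Evaluation at a point of the open unit disc. -/
noncomputable def evalHom (x : PadicAlgCl p) (hx : ‖x‖ < 1) :
    PowerSeries ℤ_[p] →ₐ[ℤ_[p]] PadicAlgCl p where
  toFun g := eval g x
  map_one' := by simpa using eval_C (1 : ℤ_[p]) x
  map_mul' g h := eval_mul g h hx
  map_zero' := by simpa using eval_C (0 : ℤ_[p]) x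
  map_add' g h := eval_add g h hx
  commutes' a := eval_C a x

theorem evalHom_apply (x : PadicAlgCl p) (hx : ‖x‖ < 1) (g : PowerSeries ℤ_[p]) :
    evalHom x hx g = eval g x := rfl

theorem eval_sub (g h : PowerSeries ℤ_[p]) {x : PadicAlgCl p} (hx : ‖x‖ < 1) :
    eval (g - h) x = eval g x - eval h x := map_sub (evalHom x hx) g h

theorem eval_pow (g : PowerSeries ℤ_[p]) (n : ℕ) {x : PadicAlgCl p} (hx : ‖x‖ < 1) :
    eval (g ^ n) x = eval g x ^ n := map_pow (evalHom x hx) g n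

theorem eval_coe (P : Polynomial ℤ_[p]) {x : PadicAlgCl p} (hx : ‖x‖ < 1) :
    eval (P : PowerSeries ℤ_[p]) x = Polynomial.aeval x P := by
  have h : (evalHom x hx).comp (Polynomial.coeToPowerSeries.algHom ℤ_[p]) =
      Polynomial.aeval x := by
    ext
    simp [evalHom_apply, Polynomial.coeToPowerSeries.algHom_apply, eval_X]
  simpa [evalHom_apply, Polynomial.coeToPowerSeries.algHom_apply] using DFunLike.congr_fun h P

theorem norm_eval_le_one (g : PowerSeries ℤ_[p]) {x : PadicAlgCl p} (hx : ‖x‖ < 1) :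
    ‖eval g x‖ ≤ 1 := by
  rw [eval_eq_tsum]
  refine (IsUltrametricDist.norm_tsum_le _).trans (ciSup_le fun k => ?_)
  exact (norm_term_le _ x k).trans (pow_le_one₀ (norm_nonneg x) hx.le)

theorem norm_eval_sub_le (g : PowerSeries ℤ_[p]) {x : PadicAlgCl p} (hx : ‖x‖ < 1) :
    ‖eval g x - algebraMap ℤ_[p] (PadicAlgCl p) (constantCoeff g)‖ ≤ ‖x‖ := by
  have h := congrArg (fun h => eval h x) (eq_X_mul_shift_add_const g)
  simp only [eval_add _ _ hx, eval_mul _ _ hx, eval_X, eval_C] at h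
  rw [h, add_sub_cancel_right, norm_mul]
  exact mul_le_of_le_one_right (norm_nonneg x) (norm_eval_le_one _ hx)

theorem norm_eval_le {g : PowerSeries ℤ_[p]} (hg : constantCoeff g = 0) {x : PadicAlgCl p}
    (hx : ‖x‖ < 1) : ‖eval g x‖ ≤ ‖x‖ := by
  simpa [hg] using norm_eval_sub_le g hx

theorem norm_eval_lt_one {g : PowerSeries ℤ_[p]} (hg : constantCoeff g = 0) {x : PadicAlgCl p}
    (hx : ‖x‖ < 1) : ‖eval g x‖ < 1 := (norm_eval_le hg hx).trans_lt hx

theorem eval_zero_right (g : PowerSeries ℤ_[p]) :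
    eval g 0 = algebraMap ℤ_[p] (PadicAlgCl p) (constantCoeff g) := by
  simpa [sub_eq_zero] using norm_eval_sub_le g (x := 0) (by simp)

theorem eval_ne_zero_of_isUnit {g : PowerSeries ℤ_[p]} (hg : IsUnit g) {x : PadicAlgCl p}
    (hx : ‖x‖ < 1) : eval g x ≠ 0 :=
  (hg.map (evalHom x hx)).ne_zero

/-- Truncate `g` at degree `N`: the polynomial parts of both sides agree and the remainders are
multiples of `y ^ N`, so the difference has norm at most `‖y‖ ^ N` for every `N`. No double series
has to be rearranged. -/
theorem eval_comp (g : PowerSeries ℤ_[p]) {h : PowerSeries ℤ_[p]} (hh : constantCoeff h = 0)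
    {x : PadicAlgCl p} (hx : ‖x‖ < 1) : eval (comp g h) x = eval g (eval h x) := by
  have hs : HasSubst h := HasSubst.of_constantCoeff_zero' hh
  have hy : ‖eval h x‖ < 1 := norm_eval_lt_one hh hx
  set y := eval h x with hy_def
  have key : ∀ N : ℕ, ‖eval (comp g h) x - eval g y‖ ≤ ‖y‖ ^ N := by
    intro N
    set r : PowerSeries ℤ_[p] := mk fun i => coeff (i + N) g
    have hg : g = X ^ N * r + (trunc N g : PowerSeries ℤ_[p]) := eq_X_pow_mul_shift_add_trunc N g
    have h1 : comp g h = h ^ N * comp r h + Polynomial.aeval h (trunc N g) := by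
      conv_lhs => rw [hg]
      simp only [comp]
      rw [subst_add hs, subst_mul hs, subst_pow hs, subst_X hs, subst_coe hs]
    have h2 : eval (Polynomial.aeval h (trunc N g)) x = Polynomial.aeval y (trunc N g) := by
      rw [← evalHom_apply x hx, ← Polynomial.aeval_algHom_apply]; rfl
    have h3 : eval g y = y ^ N * eval r y + Polynomial.aeval y (trunc N g) := by
      conv_lhs => rw [hg]
      rw [eval_add _ _ hy, eval_mul _ _ hy, eval_pow _ _ hy, eval_X, eval_coe _ hy]
    rw [h1, eval_add _ _ hx, eval_mul _ _ hx, eval_pow _ _ hx, h2, h3, add_sub_add_right_eq_sub,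
      ← hy_def, ← mul_sub, norm_mul, norm_pow]
    refine mul_le_of_le_one_right (by positivity) ?_
    rw [sub_eq_add_neg]
    refine (IsUltrametricDist.norm_add_le_max _ _).trans (max_le ?_ ?_)
    · exact norm_eval_le_one _ hx
    · exact (norm_neg _).trans_le (norm_eval_le_one _ hy)
  have h0 := ge_of_tendsto' (tendsto_pow_atTop_nhds_zero_of_lt_one (norm_nonneg y) hy) key
  exact sub_eq_zero.mp (norm_eq_zero.mp (le_antisymm h0 (norm_nonneg _)))

/-! ### Formal composition and iteration -/

section Formal

variable {R : Type*} [CommRing R]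

theorem constantCoeff_comp (g : PowerSeries R) {h : PowerSeries R} (hh : constantCoeff h = 0) :
    constantCoeff (comp g h) = constantCoeff g := by
  have hs : HasSubst h := HasSubst.of_constantCoeff_zero' hh
  conv_lhs => rw [eq_X_mul_shift_add_const g]
  rw [comp, subst_add hs, subst_mul hs, subst_X hs, subst_C]
  simp only [map_add, map_mul, hh, zero_mul, zero_add]
  exact constantCoeff_C _

theorem derivative_comp (g : PowerSeries R) {h : PowerSeries R} (hh : constantCoeff h = 0) :
    d⁄dX R (comp g h) = comp (d⁄dX R g) h * d⁄dX R h :=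
  derivative_subst (HasSubst.of_constantCoeff_zero' hh)

theorem constantCoeff_derivative (g : PowerSeries R) :
    constantCoeff (d⁄dX R g) = coeff 1 g := by
  rw [← coeff_zero_eq_constantCoeff_apply, coeff_derivative]
  simp

theorem coeff_one_comp (g : PowerSeries R) {h : PowerSeries R} (hh : constantCoeff h = 0) :
    coeff 1 (comp g h) = coeff 1 g * coeff 1 h := by
  rw [← constantCoeff_derivative, derivative_comp g hh, map_mul, constantCoeff_comp _ hh,
    constantCoeff_derivative, constantCoeff_derivative]

theorem comp_assoc (a : PowerSeries R) {b c : PowerSeries R} (hb : constantCoeff b = 0)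
    (hc : constantCoeff c = 0) : comp (comp a b) c = comp a (comp b c) :=
  subst_comp_subst_apply (HasSubst.of_constantCoeff_zero' hb)
    (HasSubst.of_constantCoeff_zero' hc) a

theorem comp_X (g : PowerSeries R) : comp g X = g := X_subst g

theorem X_comp {h : PowerSeries R} (hh : constantCoeff h = 0) : comp X h = h :=
  subst_X (HasSubst.of_constantCoeff_zero' hh)

theorem comp_add (a b : PowerSeries R) {h : PowerSeries R} (hh : constantCoeff h = 0) :
    comp (a + b) h = comp a h + comp b h :=
  subst_add (HasSubst.of_constantCoeff_zero' hh) a b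

theorem comp_mul (a b : PowerSeries R) {h : PowerSeries R} (hh : constantCoeff h = 0) :
    comp (a * b) h = comp a h * comp b h :=
  subst_mul (HasSubst.of_constantCoeff_zero' hh) a b

theorem comp_pow (a : PowerSeries R) (n : ℕ) {h : PowerSeries R} (hh : constantCoeff h = 0) :
    comp (a ^ n) h = comp a h ^ n :=
  subst_pow (HasSubst.of_constantCoeff_zero' hh) a n

theorem comp_C (a : R) (h : PowerSeries R) : comp (C a) h = C a := subst_C a

theorem map_comp {S : Type*} [CommRing S] (φ : R →+* S) (g : PowerSeries R) {h : PowerSeries R}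
    (hh : constantCoeff h = 0) : map φ (comp g h) = comp (map φ g) (map φ h) :=
  map_subst (HasSubst.of_constantCoeff_zero' hh) g

theorem constantCoeff_iter {g : PowerSeries R} (hg : constantCoeff g = 0) (n : ℕ) :
    constantCoeff (iter g n) = 0 := by
  induction n with
  | zero => exact constantCoeff_X
  | succ n ih => rw [iter, constantCoeff_comp _ ih, hg]

theorem coeff_one_iter {g : PowerSeries R} (hg : constantCoeff g = 0) (n : ℕ) :
    coeff 1 (iter g n) = coeff 1 g ^ n := by
  induction n with
  | zero => simp [iter]
  | succ n ih => rw [iter, coeff_one_comp _ (constantCoeff_iter hg n), ih, pow_succ']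

theorem iter_add {g : PowerSeries R} (hg : constantCoeff g = 0) (m n : ℕ) :
    iter g (m + n) = comp (iter g m) (iter g n) := by
  induction m with
  | zero => rw [zero_add, iter, X_comp (constantCoeff_iter hg n)]
  | succ m ih =>
    rw [Nat.succ_add, iter, ih, iter,
      comp_assoc _ (constantCoeff_iter hg m) (constantCoeff_iter hg n)]

theorem iter_one (g : PowerSeries R) : iter g 1 = g := comp_X g

theorem comp_iter_comm {a b : PowerSeries R} (ha : constantCoeff a = 0)
    (hb : constantCoeff b = 0) (hab : comp a b = comp b a) (n : ℕ) :
    comp a (iter b n) = comp (iter b n) a := by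
  induction n with
  | zero => rw [iter, comp_X, X_comp ha]
  | succ n ih =>
    have hn := constantCoeff_iter hb n
    rw [iter, ← comp_assoc _ hb hn, hab, comp_assoc _ ha hn, ih, comp_assoc _ hn ha]

theorem iter_comp_iter_comm {a b : PowerSeries R} (ha : constantCoeff a = 0)
    (hb : constantCoeff b = 0) (hab : comp a b = comp b a) (m n : ℕ) :
    comp (iter a m) (iter b n) = comp (iter b n) (iter a m) :=
  (comp_iter_comm (constantCoeff_iter hb n) ha (comp_iter_comm ha hb hab n).symm m).symm

/-- Over a domain, if `g = X ^ k * g'` with `g'(0) ≠ 0`, then `g ∘ h = h ^ k * (g' ∘ h)`, and the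
second factor has the same nonzero constant term. -/
theorem eq_zero_of_comp_eq_zero [IsDomain R] {g h : PowerSeries R} (hh : constantCoeff h = 0)
    (h0 : h ≠ 0) (hgh : comp g h = 0) : g = 0 := by
  by_contra hg
  obtain ⟨g', hg'⟩ := X_pow_order_dvd (φ := g)
  have hc : constantCoeff g' ≠ 0 := by
    have := coeff_order hg
    rw [congrArg (coeff g.order.toNat) hg', coeff_X_pow_mul'] at this
    simpa using this
  rw [hg', comp_mul _ _ hh, comp_pow _ _ hh, X_comp hh, mul_eq_zero] at hgh
  rcases hgh with h1 | h1
  · exact pow_ne_zero _ h0 h1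
  · exact hc (by rw [← constantCoeff_comp g' hh, h1, map_zero])

theorem C_dvd_iff (a : R) (g : PowerSeries R) : C a ∣ g ↔ ∀ n, a ∣ coeff n g := by
  constructor
  · rintro ⟨h, rfl⟩ n
    exact ⟨coeff n h, coeff_C_mul n h a⟩
  · intro h
    choose b hb using h
    exact ⟨mk b, by ext n; rw [coeff_C_mul, coeff_mk, hb]⟩

/-- The series `g` with `f = X * g` for `f(0) = 0`. -/
noncomputable def shift (f : PowerSeries R) : PowerSeries R := mk fun i => coeff (i + 1) f

theorem X_mul_shift {f : PowerSeries R} (hf : constantCoeff f = 0) : X * shift f = f := by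
  conv_rhs => rw [eq_X_mul_shift_add_const f]
  simp [hf, shift]

theorem constantCoeff_shift (f : PowerSeries R) : constantCoeff (shift f) = coeff 1 f := by
  rw [← coeff_zero_eq_constantCoeff_apply, shift, coeff_mk]

/-- The quotient of consecutive iterates of `f`. -/
noncomputable def iterQuot (f : PowerSeries R) (m : ℕ) : PowerSeries R := comp (shift f) (iter f m)

theorem iter_succ_eq_mul {f : PowerSeries R} (hf : constantCoeff f = 0) (m : ℕ) :
    iter f (m + 1) = iter f m * iterQuot f m := by
  have hm := constantCoeff_iter hf m
  calc comp f (iter f m) = comp (X * shift f) (iter f m) := by rw [X_mul_shift hf]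
    _ = iter f m * iterQuot f m := by rw [comp_mul _ _ hm, X_comp hm, iterQuot]

theorem constantCoeff_iterQuot {f : PowerSeries R} (hf : constantCoeff f = 0) (m : ℕ) :
    constantCoeff (iterQuot f m) = coeff 1 f := by
  rw [iterQuot, constantCoeff_comp _ (constantCoeff_iter hf m), constantCoeff_shift]

theorem iter_ne_zero {f : PowerSeries R} [IsDomain R] (hf : constantCoeff f = 0) (h0 : f ≠ 0)
    (m : ℕ) : iter f m ≠ 0 := by
  induction m with
  | zero => exact X_ne_zero
  | succ m ih => exact fun h => h0 (eq_zero_of_comp_eq_zero (constantCoeff_iter hf m) ih h)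

theorem map_iter {S : Type*} [CommRing S] (φ : R →+* S) {g : PowerSeries R}
    (hg : constantCoeff g = 0) (n : ℕ) : map φ (iter g n) = iter (map φ g) n := by
  induction n with
  | zero => exact map_X φ
  | succ n ih => rw [iter, map_comp φ g (constantCoeff_iter hg n), ih, iter]

end Formal

/-! ### Weierstrass preparation and zeros in the disc -/

theorem map_residue_eq_zero_iff (h : PowerSeries ℤ_[p]) :
    map (IsLocalRing.residue ℤ_[p]) h = 0 ↔ C (p : ℤ_[p]) ∣ h := by
  rw [C_dvd_iff, PowerSeries.ext_iff]
  refine forall_congr' fun n => ?_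
  rw [coeff_map, map_zero, IsLocalRing.residue_eq_zero_iff, PadicInt.maximalIdeal_eq_span_p,
    Ideal.mem_span_singleton]

theorem map_residue_iterQuot_ne_zero {f : PowerSeries ℤ_[p]} (hf : constantCoeff f = 0)
    (h0 : map (IsLocalRing.residue ℤ_[p]) f ≠ 0) (m : ℕ) :
    map (IsLocalRing.residue ℤ_[p]) (iterQuot f m) ≠ 0 := by
  intro h
  have := iter_ne_zero (f := map (IsLocalRing.residue ℤ_[p]) f) 
    (by rw [← coeff_zero_eq_constantCoeff_apply, coeff_map, coeff_zero_eq_constantCoeff_apply, hf,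
      map_zero]) h0 (m + 1)
  rw [← map_iter _ hf, iter_succ_eq_mul hf, map_mul, h, mul_zero] at this
  exact this rfl

theorem exists_eq_p_pow_mul {h : PowerSeries ℤ_[p]} (h0 : h ≠ 0) :
    ∃ (c : ℕ) (g : PowerSeries ℤ_[p]), h = C ((p : ℤ_[p]) ^ c) * g ∧
      map (IsLocalRing.residue ℤ_[p]) g ≠ 0 := by
  obtain ⟨k, hk⟩ : ∃ k, coeff k h ≠ 0 := by
    by_contra! hk
    exact h0 (PowerSeries.ext hk)
  have hfin : FiniteMultiplicity (C (p : ℤ_[p])) h := by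
    obtain ⟨n, hn⟩ := FiniteMultiplicity.of_not_isUnit PadicInt.prime_p.not_isUnit hk
    refine ⟨n, fun hd => hn ?_⟩
    rw [← map_pow] at hd
    exact (C_dvd_iff _ _).mp hd k
  obtain ⟨g, hg, hg'⟩ := hfin.exists_eq_pow_mul_and_not_dvd
  refine ⟨_, g, by rw [map_pow]; exact hg, ?_⟩
  rwa [Ne, map_residue_eq_zero_iff]

/-- Roots of distinguished polynomials lie in the open unit disc. -/
theorem norm_lt_one_of_aeval_eq_zero {D : Polynomial ℤ_[p]}
    (hD : D.IsDistinguishedAt (IsLocalRing.maximalIdeal ℤ_[p])) {x : PadicAlgCl p}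
    (hx : Polynomial.aeval x D = 0) : ‖x‖ < 1 := by
  by_contra! h1
  have hlt : ‖(p : ℤ_[p])‖ < 1 := by
    rw [PadicInt.norm_p]
    exact inv_lt_one_of_one_lt₀ (mod_cast (Fact.out : p.Prime).one_lt)
  rw [Polynomial.aeval_eq_sum_range, Finset.sum_range_succ, hD.monic.coeff_natDegree, one_smul,
    add_comm, add_eq_zero_iff_eq_neg] at hx
  -- For `‖x‖ ≥ 1` the lower terms, with coefficients divisible by `p`, are too small to cancel the
  -- leading one.
  have hb : ‖x ^ D.natDegree‖ ≤ ‖(p : ℤ_[p])‖ * ‖x‖ ^ D.natDegree := by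
    rw [hx, norm_neg]
    refine IsUltrametricDist.norm_sum_le_of_forall_le_of_nonneg (by positivity) fun i hi => ?_
    have hi' := Finset.mem_range.mp hi
    have hc := hD.mem hi'
    rw [PadicInt.maximalIdeal_eq_span_p, Ideal.mem_span_singleton] at hc
    obtain ⟨b, hb⟩ := hc
    rw [Algebra.smul_def, norm_mul, norm_algebraMap_padicInt, norm_pow, hb, norm_mul]
    refine mul_le_mul (mul_le_of_le_one_right (norm_nonneg _) b.norm_le_one)
      (pow_le_pow_right₀ h1 hi'.le) (by positivity) (norm_nonneg _)
  rw [norm_pow] at hb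
  have : 0 < ‖x‖ ^ D.natDegree := by positivity
  nlinarith

theorem exists_eq_p_pow_mul_distinguished_mul_unit {h : PowerSeries ℤ_[p]} (h0 : h ≠ 0) :
    ∃ (c : ℕ) (D : Polynomial ℤ_[p]) (U : PowerSeries ℤ_[p]),
      h = C ((p : ℤ_[p]) ^ c) * (D * U) ∧ IsUnit U ∧
        D.IsDistinguishedAt (IsLocalRing.maximalIdeal ℤ_[p]) := by
  obtain ⟨c, g, hg, hg0⟩ := exists_eq_p_pow_mul h0
  obtain ⟨D, U, H⟩ := exists_isWeierstrassFactorization hg0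
  exact ⟨c, D, U, by rw [hg, ← H.eq_mul], H.isUnit, H.isDistinguishedAt⟩

theorem eval_C_p_pow_ne_zero (c : ℕ) (x : PadicAlgCl p) :
    eval (C ((p : ℤ_[p]) ^ c)) x ≠ 0 := by
  rw [eval_C, Ne, map_eq_zero_iff _ algebraMap_padicInt_injective]
  exact pow_ne_zero _ PadicInt.prime_p.ne_zero

/-- A nonzero series without zeros in the open unit disc is a power of `p` times a unit. -/
theorem exists_eq_p_pow_mul_unit {h : PowerSeries ℤ_[p]} (h0 : h ≠ 0)
    (hroot : ∀ x : PadicAlgCl p, ‖x‖ < 1 → eval h x ≠ 0) :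
    ∃ (c : ℕ) (U : PowerSeries ℤ_[p]), h = C ((p : ℤ_[p]) ^ c) * U ∧ IsUnit U := by
  obtain ⟨c, D, U, rfl, hU, hD⟩ := exists_eq_p_pow_mul_distinguished_mul_unit h0
  rcases eq_or_ne D.natDegree 0 with hd | hd
  · rw [Polynomial.eq_one_of_monic_natDegree_zero hD.monic hd]
    exact ⟨c, U, by simp, hU⟩
  · exfalso
    obtain ⟨x, hx⟩ := IsAlgClosed.exists_aeval_eq_zero_of_injective (PadicAlgCl p)
      algebraMap_padicInt_injective D
      (fun h => hd (Polynomial.natDegree_eq_of_degree_eq_some h))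
    have hx1 := norm_lt_one_of_aeval_eq_zero hD hx
    refine hroot x hx1 ?_
    rw [eval_mul _ _ hx1, eval_mul _ _ hx1, eval_coe _ hx1, hx, zero_mul, mul_zero]

/-- A nonzero series has finitely many zeros in the open unit disc. -/
theorem finite_zeros {h : PowerSeries ℤ_[p]} (h0 : h ≠ 0) :
    {x : PadicAlgCl p | ‖x‖ < 1 ∧ eval h x = 0}.Finite := by
  obtain ⟨c, D, U, rfl, hU, hD⟩ := exists_eq_p_pow_mul_distinguished_mul_unit h0
  refine (Polynomial.rootSet_finite (D.map (algebraMap ℤ_[p] ℚ_[p])) (PadicAlgCl p)).subset ?_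
  rintro x ⟨hx, hx0⟩
  rw [eval_mul _ _ hx, eval_mul _ _ hx, eval_coe _ hx] at hx0
  have hx' : Polynomial.aeval x D = 0 := by
    have h := (mul_eq_zero.mp hx0).resolve_left (eval_C_p_pow_ne_zero c x)
    exact (mul_eq_zero.mp h).resolve_right (eval_ne_zero_of_isUnit hU hx)
  rw [Polynomial.mem_rootSet_of_ne (hD.monic.map _).ne_zero, Polynomial.aeval_map_algebraMap, hx']

/-! ### Eisenstein series -/

/-- Series whose Weierstrass polynomial is an Eisenstein polynomial. -/
structure IsEisensteinSeries (q : PowerSeries ℤ_[p]) : Prop where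
  map_residue_ne_zero : map (IsLocalRing.residue ℤ_[p]) q ≠ 0
  p_dvd : (p : ℤ_[p]) ∣ constantCoeff q
  not_sq_dvd : ¬ (p : ℤ_[p]) ^ 2 ∣ constantCoeff q

namespace IsEisensteinSeries

variable {q : PowerSeries ℤ_[p]}

theorem irreducible_map (hq : IsEisensteinSeries q) {P : Polynomial ℤ_[p]} {U : PowerSeries ℤ_[p]}
    (H : q.IsWeierstrassFactorization P U) :
    Irreducible (P.map (algebraMap ℤ_[p] ℚ_[p])) := by
  have hD := H.isDistinguishedAt
  have hq0 : constantCoeff q = P.coeff 0 * constantCoeff U := by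
    rw [H.eq_mul, map_mul, Polynomial.constantCoeff_coe]
  have hU := H.isUnit.map (constantCoeff (R := ℤ_[p]))
  have hp : (p : ℤ_[p]) ∣ P.coeff 0 := by
    have := hq.p_dvd
    rwa [hq0, hU.dvd_mul_right] at this
  have hdeg : 0 < P.natDegree := by
    refine Nat.pos_of_ne_zero fun h =>
      (PadicInt.prime_p (p := p)).not_isUnit (isUnit_of_dvd_one ?_)
    simpa [Polynomial.eq_one_of_monic_natDegree_zero hD.monic h] using hp
  rw [← hD.monic.irreducible_iff_irreducible_map_fraction_map]
  refine Polynomial.IsEisensteinAt.irreducible (𝓟 := IsLocalRing.maximalIdeal ℤ_[p])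
    ⟨?_, fun h => hD.mem h, ?_⟩ (IsLocalRing.maximalIdeal.isMaximal _).isPrime
    hD.monic.isPrimitive hdeg
  · rw [hD.monic.leadingCoeff]
    exact (Ideal.ne_top_iff_one _).mp (IsLocalRing.maximalIdeal.isMaximal _).ne_top
  · rw [PadicInt.maximalIdeal_eq_span_p, Ideal.span_singleton_pow, Ideal.mem_span_singleton]
    intro h
    exact hq.not_sq_dvd (hq0 ▸ h.mul_right _)

theorem aeval_eq_zero {P : Polynomial ℤ_[p]} {U : PowerSeries ℤ_[p]}
    (H : q.IsWeierstrassFactorization P U) {x : PadicAlgCl p} (hx : ‖x‖ < 1)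
    (hqx : eval q x = 0) : Polynomial.aeval x P = 0 := by
  rw [H.eq_mul, eval_mul _ _ hx, eval_coe _ hx] at hqx
  exact (mul_eq_zero.mp hqx).resolve_right (eval_ne_zero_of_isUnit H.isUnit hx)

/-- A series vanishing at a zero of an Eisenstein series is divisible by it. -/
theorem dvd_of_eval_eq_zero (hq : IsEisensteinSeries q) {x : PadicAlgCl p} (hx : ‖x‖ < 1)
    (hqx : eval q x = 0) {h : PowerSeries ℤ_[p]} (hhx : eval h x = 0) : q ∣ h := by
  obtain ⟨P, U, H⟩ := exists_isWeierstrassFactorization hq.map_residue_ne_zero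
  -- The Weierstrass remainder `r` vanishes at `x` and has degree below that of `P`, the minimal
  -- polynomial of `x`; hence `r = 0`.
  obtain ⟨s, r, hsr⟩ := exists_isWeierstrassDivision h hq.map_residue_ne_zero
  have hdeg : r.degree < P.natDegree := by
    rw [H.natDegree_eq_toNat_order_map]
    exact hsr.degree_lt
  have hrx : Polynomial.aeval x r = 0 := by
    have := congrArg (fun h => eval h x) hsr.eq_mul_add
    simp only [eval_add _ _ hx, eval_mul _ _ hx, eval_coe _ hx, hqx, hhx, zero_mul,
      zero_add] at this
    exact this.symm
  have hmin : P.map (algebraMap ℤ_[p] ℚ_[p]) = minpoly ℚ_[p] x :=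
    minpoly.eq_of_irreducible_of_monic (hq.irreducible_map H)
      (by rw [Polynomial.aeval_map_algebraMap, aeval_eq_zero H hx hqx])
      (H.isDistinguishedAt.monic.map _)
  have hr : r.map (algebraMap ℤ_[p] ℚ_[p]) = 0 := by
    refine Polynomial.eq_zero_of_dvd_of_degree_lt
      (p := P.map (algebraMap ℤ_[p] ℚ_[p])) ?_ ?_
    · rw [hmin]
      exact minpoly.dvd _ _ (by rw [Polynomial.aeval_map_algebraMap, hrx])
    · rw [H.isDistinguishedAt.monic.degree_map,
        Polynomial.degree_eq_natDegree H.isDistinguishedAt.monic.ne_zero]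
      exact (Polynomial.degree_map_le).trans_lt hdeg
  have hr0 : r = 0 :=
    (Polynomial.map_eq_zero_iff (FaithfulSMul.algebraMap_injective ℤ_[p] ℚ_[p])).mp hr
  exact ⟨s, by rw [hsr.eq_mul_add, hr0, Polynomial.coe_zero, add_zero]⟩

/-- The zeros of an Eisenstein series are simple. -/
theorem eval_derivative_ne_zero (hq : IsEisensteinSeries q) {x : PadicAlgCl p} (hx : ‖x‖ < 1)
    (hqx : eval q x = 0) : eval (d⁄dX ℤ_[p] q) x ≠ 0 := by
  obtain ⟨P, U, H⟩ := exists_isWeierstrassFactorization hq.map_residue_ne_zero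
  have hPx := aeval_eq_zero H hx hqx
  have hsep := (hq.irreducible_map H).separable.aeval_derivative_ne_zero (x := x)
    (by rw [Polynomial.aeval_map_algebraMap, hPx])
  rw [Polynomial.derivative_map, Polynomial.aeval_map_algebraMap] at hsep
  have : eval (d⁄dX ℤ_[p] q) x = Polynomial.aeval x (Polynomial.derivative P) * eval U x := by
    rw [H.eq_mul, Derivation.leibniz, smul_eq_mul, smul_eq_mul, eval_add _ _ hx, eval_mul _ _ hx,
      eval_mul _ _ hx, eval_coe _ hx, hPx, derivative_coe, eval_coe _ hx]
    ring
  rw [this]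
  exact mul_ne_zero hsep (eval_ne_zero_of_isUnit H.isUnit hx)

end IsEisensteinSeries

/-! ### Lifting the exponent -/

theorem isUnit_iff_not_dvd (a : ℤ_[p]) : IsUnit a ↔ ¬ (p : ℤ_[p]) ∣ a := by
  rw [← Ideal.mem_span_singleton, ← PadicInt.maximalIdeal_eq_span_p, IsLocalRing.mem_maximalIdeal,
    mem_nonunits_iff, not_not]

theorem isUnit_one_add_p_mul (a : ℤ_[p]) : IsUnit (1 + (p : ℤ_[p]) * a) := by
  rw [isUnit_iff_not_dvd, dvd_add_left (dvd_mul_right _ _)]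
  exact fun h => PadicInt.prime_p.not_isUnit (isUnit_of_dvd_one h)

theorem one_le_delta (p : ℕ) : 1 ≤ delta p := by
  unfold delta
  split_ifs <;> decide

/-- This is where `δ` matters: for `p = 2` the sum is `2 * (1 + 2 ^ (s - 1) * t)`, which has
valuation 1 for every `t` only if `s ≥ 2`. -/
theorem exists_geom_sum_eq {s : ℕ} (hs : delta p ≤ s) (t : ℤ_[p]) :
    ∃ z, ∑ i ∈ Finset.range p, (1 + (p : ℤ_[p]) ^ s * t) ^ i = p * (1 + p * z) := by
  obtain ⟨s, rfl⟩ := Nat.exists_eq_add_of_le ((one_le_delta p).trans hs)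
  rcases (Fact.out : p.Prime).eq_two_or_odd' with hp | hp
  · subst hp
    obtain ⟨r, rfl⟩ : ∃ r, s = r + 1 := ⟨s - 1, by simp [delta] at hs; omega⟩
    refine ⟨2 ^ r * t, ?_⟩
    rw [Finset.sum_range_succ, Finset.sum_range_one]
    push_cast
    ring
  · obtain ⟨z, hz⟩ := odd_sq_dvd_geom_sum₂_sub (R := ℤ_[p]) (a := 1) (b := (p : ℤ_[p]) ^ s * t) hp
    refine ⟨z, ?_⟩
    rw [sub_eq_iff_eq_add] at hz
    simp only [one_pow, mul_one] at hz
    rw [pow_add, pow_one, mul_assoc, hz]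
    ring

theorem exists_pow_p_eq {s : ℕ} (hs : delta p ≤ s) {t : ℤ_[p]} (ht : IsUnit t) :
    ∃ t', IsUnit t' ∧ (1 + (p : ℤ_[p]) ^ s * t) ^ p = 1 + (p : ℤ_[p]) ^ (s + 1) * t' := by
  obtain ⟨z, hz⟩ := exists_geom_sum_eq hs t
  refine ⟨(1 + p * z) * t, (isUnit_one_add_p_mul z).mul ht, ?_⟩
  have := geom_sum_mul (1 + (p : ℤ_[p]) ^ s * t) p
  rw [hz] at this
  linear_combination -this

theorem exists_pow_eq_of_not_dvd {s : ℕ} (hs : 1 ≤ s) {t : ℤ_[p]} (ht : IsUnit t) {e : ℕ}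
    (he : ¬ p ∣ e) :
    ∃ t', IsUnit t' ∧ (1 + (p : ℤ_[p]) ^ s * t) ^ e = 1 + (p : ℤ_[p]) ^ s * t' := by
  set a := 1 + (p : ℤ_[p]) ^ s * t with ha
  have hpa : (p : ℤ_[p]) ∣ a - 1 :=
    ⟨p ^ (s - 1) * t, by rw [ha, ← mul_assoc, ← pow_succ', Nat.sub_add_cancel hs]; ring⟩
  -- As `a ≡ 1` modulo `p`, the geometric sum is congruent to `e`, hence a unit.
  have hsum : (p : ℤ_[p]) ∣ ∑ i ∈ Finset.range e, a ^ i - e := by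
    have : ∑ i ∈ Finset.range e, a ^ i - e = ∑ i ∈ Finset.range e, (a ^ i - 1) := by simp
    rw [this]
    refine Finset.dvd_sum fun i _ => hpa.trans ?_
    simpa using sub_dvd_pow_sub_pow a 1 i
  have hu : IsUnit (∑ i ∈ Finset.range e, a ^ i) := by
    rw [isUnit_iff_not_dvd]
    intro h
    have h' := (dvd_sub_right h).mp hsum
    rw [← PadicInt.norm_lt_one_iff_dvd, PadicInt.norm_natCast_lt_one_iff] at h'
    exact he h'
  refine ⟨(∑ i ∈ Finset.range e, a ^ i) * t, hu.mul ht, ?_⟩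
  have := geom_sum_mul a e
  linear_combination -this + (∑ i ∈ Finset.range e, a ^ i) * ha

theorem exists_pow_p_pow_eq {s : ℕ} (hs : delta p ≤ s) {t : ℤ_[p]} (ht : IsUnit t) (k : ℕ) :
    ∃ t', IsUnit t' ∧ (1 + (p : ℤ_[p]) ^ s * t) ^ p ^ k = 1 + (p : ℤ_[p]) ^ (s + k) * t' := by
  induction k with
  | zero => exact ⟨t, ht, by simp⟩
  | succ k ih =>
    obtain ⟨t₁, ht₁, h₁⟩ := ih
    obtain ⟨t₂, ht₂, h₂⟩ := exists_pow_p_eq (hs.trans (Nat.le_add_right s k)) ht₁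
    exact ⟨t₂, ht₂, by rw [pow_succ, pow_mul, h₁, h₂, add_assoc]⟩

/-- Lifting the exponent in `ℤ_p`. -/
theorem exists_pow_sub_one_eq {a : ℤ_[p]} (ha : a ≠ 1) (hv : (a - 1).valuation = delta p) {d : ℕ}
    (hd : d ≠ 0) :
    ∃ t, IsUnit t ∧ a ^ d - 1 = (p : ℤ_[p]) ^ (delta p + padicValNat p d) * t := by
  have ha' : a - 1 ≠ 0 := sub_ne_zero.mpr ha
  have hs := PadicInt.unitCoeff_spec ha'
  rw [hv] at hs
  have ha1 : a = 1 + (p : ℤ_[p]) ^ delta p * (PadicInt.unitCoeff ha' : ℤ_[p]) := by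
    linear_combination hs
  have hp : p.Prime := Fact.out
  obtain ⟨k, e, he, rfl⟩ := Nat.exists_eq_pow_mul_and_not_dvd hd p hp.ne_one
  have he0 : e ≠ 0 := fun h => he (h ▸ dvd_zero p)
  rw [padicValNat.mul (pow_ne_zero k hp.ne_zero) he0, padicValNat.prime_pow,
    padicValNat.eq_zero_of_not_dvd he, add_zero]
  obtain ⟨t₁, ht₁, h₁⟩ := exists_pow_p_pow_eq le_rfl (PadicInt.unitCoeff ha').isUnit k
  obtain ⟨t₂, ht₂, h₂⟩ :=
    exists_pow_eq_of_not_dvd ((one_le_delta p).trans (Nat.le_add_right _ k)) ht₁ he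
  exact ⟨t₂, ht₂, by rw [ha1, pow_mul, h₁, h₂, add_sub_cancel_left]⟩

/-! ### Commutation modulo powers of `p` -/

section Congruence

variable {R : Type*} [CommRing R]

theorem map_quotient_eq_zero_iff (e : R) (h : PowerSeries R) :
    map (Ideal.Quotient.mk (Ideal.span {e})) h = 0 ↔ C e ∣ h := by
  rw [C_dvd_iff, PowerSeries.ext_iff]
  refine forall_congr' fun n => ?_
  rw [coeff_map, map_zero, Ideal.Quotient.eq_zero_iff_mem, Ideal.mem_span_singleton]

theorem C_dvd_comp_sub_comp (e : R) (g : PowerSeries R) {s t : PowerSeries R}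
    (hs : constantCoeff s = 0) (ht : constantCoeff t = 0) (hst : C e ∣ s - t) :
    C e ∣ comp g s - comp g t := by
  rw [← map_quotient_eq_zero_iff, map_sub, sub_eq_zero] at hst ⊢
  rw [map_comp _ _ hs, map_comp _ _ ht, hst]

end Congruence

/-- Since `p ∣ n * coeff n f`, only exponents divisible by `p` survive modulo `p`. -/
theorem exists_eq_p_mul_add_comp_X_pow {f : PowerSeries ℤ_[p]}
    (hf : C (p : ℤ_[p]) ∣ d⁄dX ℤ_[p] f) :
    ∃ a b : PowerSeries ℤ_[p], f = C (p : ℤ_[p]) * a + comp b (X ^ p) := by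
  have hp : p.Prime := Fact.out
  set b : PowerSeries ℤ_[p] := mk fun k => coeff (p * k) f
  suffices h : C (p : ℤ_[p]) ∣ f - comp b (X ^ p) by
    obtain ⟨a, ha⟩ := h
    exact ⟨a, b, by rw [← ha, sub_add_cancel]⟩
  rw [C_dvd_iff] at hf ⊢
  intro n
  rw [map_sub, comp, coeff_subst_X_pow hp.ne_zero]
  split_ifs with hn
  · simp [b, Nat.mul_div_cancel' hn]
  · obtain ⟨m, rfl⟩ : ∃ m, n = m + 1 :=
      Nat.exists_eq_succ_of_ne_zero fun h => hn (h ▸ dvd_zero p)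
    have h := hf m
    rw [coeff_derivative] at h
    rw [sub_zero]
    refine (PadicInt.prime_p.dvd_or_dvd h).resolve_right fun h' => hn ?_
    rw [← Nat.cast_succ, ← PadicInt.norm_lt_one_iff_dvd, PadicInt.norm_natCast_lt_one_iff] at h'
    exact h'

/-- If `X + p ^ c * h` commutes with a series `f` whose derivative vanishes modulo `p`, then `h`
vanishes modulo `p`. -/
theorem C_p_dvd_of_commute {f h : PowerSeries ℤ_[p]} {c : ℕ} (hc : 1 ≤ c)
    (hf0 : constantCoeff f = 0) (hfp : map (IsLocalRing.residue ℤ_[p]) f ≠ 0)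
    (hf' : C (p : ℤ_[p]) ∣ d⁄dX ℤ_[p] f) (hh : constantCoeff h = 0)
    (hcomm : comp f (X + C ((p : ℤ_[p]) ^ c) * h) = comp (X + C ((p : ℤ_[p]) ^ c) * h) f) :
    C (p : ℤ_[p]) ∣ h := by
  have hp : p.Prime := Fact.out
  obtain ⟨a, b, hab⟩ := exists_eq_p_mul_add_comp_X_pow hf'
  set v : PowerSeries ℤ_[p] := X + C ((p : ℤ_[p]) ^ c) * h with hv
  have hv0 : constantCoeff v = 0 := by simp [hv, hh]
  have hXp : constantCoeff (X ^ p : PowerSeries ℤ_[p]) = 0 := by simp [hp.ne_zero]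
  have hvp : constantCoeff (v ^ p) = 0 := by simp [hv0, hp.ne_zero]
  have h1 : C ((p : ℤ_[p]) ^ c) ∣ comp a v - a := by
    have := C_dvd_comp_sub_comp ((p : ℤ_[p]) ^ c) a hv0 constantCoeff_X
      ⟨h, by rw [hv, add_sub_cancel_left]⟩
    rwa [comp_X] at this
  -- Raising to the `p`-th power gains a factor `p`: the linear term of the binomial expansion
  -- carries `p * p ^ c`, the rest `p ^ (2 * c)`, and `c ≥ 1`.
  have h2 : C ((p : ℤ_[p]) ^ (c + 1)) ∣ v ^ p - X ^ p := by
    have h3 := sq_dvd_add_pow_sub_sub (C ((p : ℤ_[p]) ^ c) * h) X p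
    have h4 : C ((p : ℤ_[p]) ^ (c + 1)) ∣ (C ((p : ℤ_[p]) ^ c) * h) ^ 2 := by
      rw [mul_pow, ← map_pow, ← pow_mul]
      exact (map_dvd C (pow_dvd_pow _ (by omega))).mul_right _
    have h5 : C ((p : ℤ_[p]) ^ (c + 1)) ∣
        X ^ (p - 1) * (C ((p : ℤ_[p]) ^ c) * h) * (p : PowerSeries ℤ_[p]) := by
      refine ⟨X ^ (p - 1) * h, ?_⟩
      rw [pow_succ, map_mul, map_natCast]
      ring
    have h6 := dvd_add (h4.trans h3) h5
    rwa [show (X + C ((p : ℤ_[p]) ^ c) * h) ^ p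
        - X ^ (p - 1) * (C ((p : ℤ_[p]) ^ c) * h) * (p : PowerSeries ℤ_[p]) - X ^ p
        + X ^ (p - 1) * (C ((p : ℤ_[p]) ^ c) * h) * (p : PowerSeries ℤ_[p]) = v ^ p - X ^ p by
      rw [hv]; ring] at h6
  have h7 : C ((p : ℤ_[p]) ^ (c + 1)) ∣ comp f v - f := by
    have h8 : comp f v = C (p : ℤ_[p]) * comp a v + comp b (v ^ p) := by
      conv_lhs => rw [hab]
      rw [comp_add _ _ hv0, comp_mul _ _ hv0, comp_C, comp_assoc _ hXp hv0, comp_pow _ _ hv0,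
        X_comp hv0]
    have h9 : comp f v - f = C (p : ℤ_[p]) * (comp a v - a)
        + (comp b (v ^ p) - comp b (X ^ p)) := by
      rw [h8]
      linear_combination -hab
    rw [h9]
    refine dvd_add ?_ (C_dvd_comp_sub_comp _ b hvp hXp h2)
    rw [pow_succ', map_mul]
    exact mul_dvd_mul_left _ h1
  -- The other side of the commutation gives the same difference exactly; cancelling `p ^ c` leaves
  -- `h ∘ f ≡ 0` modulo `p`.
  have h8 : comp f v - f = C ((p : ℤ_[p]) ^ c) * comp h f := by
    rw [hcomm, hv, comp_add _ _ hf0, comp_mul _ _ hf0, comp_C, X_comp hf0, add_sub_cancel_left]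
  have hne : C ((p : ℤ_[p]) ^ c) ≠ 0 := by
    rw [Ne, map_eq_zero_iff _ C_injective]
    exact pow_ne_zero _ PadicInt.prime_p.ne_zero
  rw [h8, pow_succ, map_mul, mul_dvd_mul_iff_left hne, ← map_residue_eq_zero_iff,
    map_comp _ _ hf0] at h7
  rw [← map_residue_eq_zero_iff]
  refine eq_zero_of_comp_eq_zero ?_ hfp h7
  rw [← coeff_zero_eq_constantCoeff_apply, coeff_map, coeff_zero_eq_constantCoeff_apply, hf0,
    map_zero]

/-! ### Dynamics near the origin -/

/-- A simple zero at the origin is isolated. -/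
theorem eq_zero_of_eval_eq_zero {w : PowerSeries ℤ_[p]} (hw : constantCoeff w = 0)
    {x : PadicAlgCl p} (hx : ‖x‖ < ‖coeff 1 w‖) (hwx : eval w x = 0) : x = 0 := by
  have hx1 : ‖x‖ < 1 := hx.trans_le (PadicInt.norm_le_one _)
  rw [← X_mul_shift hw, eval_mul _ _ hx1, eval_X, mul_eq_zero] at hwx
  refine hwx.resolve_right fun h => ?_
  have := norm_eval_sub_le (shift w) hx1
  rw [h, zero_sub, norm_neg, norm_algebraMap_padicInt, constantCoeff_shift] at this
  exact absurd this (not_le.mpr hx)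

theorem eq_zero_of_eval_eq_zero_of_isUnit {w : PowerSeries ℤ_[p]} (hw : constantCoeff w = 0)
    (hu : IsUnit (coeff 1 w)) {x : PadicAlgCl p} (hx : ‖x‖ < 1) (hwx : eval w x = 0) : x = 0 :=
  eq_zero_of_eval_eq_zero hw (by rwa [PadicInt.isUnit_iff.mp hu]) hwx

theorem eval_iter_succ {g : PowerSeries ℤ_[p]} (hg : constantCoeff g = 0) (n : ℕ)
    {x : PadicAlgCl p} (hx : ‖x‖ < 1) : eval (iter g (n + 1)) x = eval g (eval (iter g n) x) := by
  rw [iter, eval_comp _ (constantCoeff_iter hg n) hx]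

theorem eval_iter_add {g : PowerSeries ℤ_[p]} (hg : constantCoeff g = 0) (m n : ℕ)
    {x : PadicAlgCl p} (hx : ‖x‖ < 1) :
    eval (iter g (m + n)) x = eval (iter g m) (eval (iter g n) x) := by
  rw [iter_add hg, eval_comp _ (constantCoeff_iter hg n) hx]

theorem eval_zero_eq_zero {g : PowerSeries ℤ_[p]} (hg : constantCoeff g = 0) :
    eval g 0 = 0 := by
  rw [eval_zero_right, hg, map_zero]

theorem eval_iter_eq_zero_of_le {f : PowerSeries ℤ_[p]} (hf : constantCoeff f = 0) {m n : ℕ}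
    (hmn : m ≤ n) {x : PadicAlgCl p} (hx : ‖x‖ < 1) (h : eval (iter f m) x = 0) :
    eval (iter f n) x = 0 := by
  obtain ⟨k, rfl⟩ := Nat.exists_eq_add_of_le' hmn
  rw [eval_iter_add hf _ _ hx, h, eval_zero_eq_zero (constantCoeff_iter hf k)]

/-- A noninvertible series is attracting at the origin. -/
theorem tendsto_eval_iter {f : PowerSeries ℤ_[p]} (hf : constantCoeff f = 0)
    (hf1 : ‖coeff 1 f‖ < 1) {x : PadicAlgCl p} (hx : ‖x‖ < 1) :
    Filter.Tendsto (fun m => ‖eval (iter f m) x‖) Filter.atTop (nhds 0) := by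
  set ρ := max ‖x‖ ‖coeff 1 f‖
  have hρ : ρ < 1 := max_lt hx hf1
  have hρ0 : 0 ≤ ρ := (norm_nonneg x).trans (le_max_left _ _)
  -- Each application of `f` multiplies `y` by `shift f` at `y`, whose norm is at most `max ‖y‖
  -- ‖f'(0)‖ ≤ ρ`.
  have key : ∀ m, ‖eval (iter f m) x‖ ≤ ρ ^ m := by
    intro m
    induction m with
    | zero => rw [iter, eval_X, pow_zero]; exact hx.le
    | succ m ih =>
      rw [eval_iter_succ hf m hx]
      have hyx : ‖eval (iter f m) x‖ ≤ ‖x‖ := norm_eval_le (constantCoeff_iter hf m) hx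
      set y := eval (iter f m) x
      have hy : ‖y‖ < 1 := hyx.trans_lt hx
      have hs : ‖eval (shift f) y‖ ≤ ρ := by
        have h := norm_eval_sub_le (shift f) hy
        rw [constantCoeff_shift] at h
        rw [← sub_add_cancel (eval (shift f) y) (algebraMap ℤ_[p] (PadicAlgCl p) (coeff 1 f))]
        refine (IsUltrametricDist.norm_add_le_max _ _).trans (max_le_max (h.trans hyx) ?_)
        rw [norm_algebraMap_padicInt]
      rw [← X_mul_shift hf, eval_mul _ _ hy, eval_X, norm_mul, pow_succ]
      exact mul_le_mul ih hs (norm_nonneg _) (by positivity)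
  exact squeeze_zero (fun _ => norm_nonneg _) key (tendsto_pow_atTop_nhds_zero_of_lt_one hρ0 hρ)

theorem eval_comm {a b : PowerSeries ℤ_[p]} (ha : constantCoeff a = 0)
    (hb : constantCoeff b = 0) (hab : comp a b = comp b a) {x : PadicAlgCl p} (hx : ‖x‖ < 1) :
    eval a (eval b x) = eval b (eval a x) := by
  rw [← eval_comp _ hb hx, hab, eval_comp _ ha hx]

/-- Fixed points of a series commuting with `f` are zeros of iterates of `f`. -/
theorem exists_eval_iter_eq_zero_of_fixed {f v : PowerSeries ℤ_[p]} (hf : constantCoeff f = 0)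
    (hf1 : ‖coeff 1 f‖ < 1) (hv : constantCoeff v = 0) (hv1 : coeff 1 v ≠ 1)
    (hcomm : comp f v = comp v f) {x : PadicAlgCl p} (hx : ‖x‖ < 1) (hfix : eval v x = x) :
    ∃ m, eval (iter f m) x = 0 := by
  have hpos : 0 < ‖coeff 1 (v - X)‖ := by
    rw [norm_pos_iff, map_sub, coeff_one_X, sub_ne_zero]
    exact hv1
  obtain ⟨m, hm⟩ := ((tendsto_eval_iter hf hf1 hx).eventually (gt_mem_nhds hpos)).exists
  -- The point `f^m(x)` is still fixed by `v` and lies in the ball where `0` is the only zero of `v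
  -- - X`.
  refine ⟨m, eq_zero_of_eval_eq_zero (w := v - X) (by simp [hv]) hm ?_⟩
  have hfm := constantCoeff_iter hf m
  rw [eval_sub _ _ (norm_eval_lt_one hfm hx), eval_X,
    eval_comm hv hfm (comp_iter_comm hv hf hcomm.symm m) hx, hfix, sub_self]

/-! ### Minimal pairs: simple roots, fixed points, factorization -/

namespace IsMinimalCommutingPair

variable {f u : PowerSeries ℤ_[p]}

theorem constantCoeff_f (H : IsMinimalCommutingPair f u) : constantCoeff f = 0 := H.f_mem.1

theorem constantCoeff_u (H : IsMinimalCommutingPair f u) : constantCoeff u = 0 :=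
  H.u_invertible.1.1

theorem exists_coeff_one_f (H : IsMinimalCommutingPair f u) :
    ∃ t, IsUnit t ∧ coeff 1 f = p * t := by
  have h := PadicInt.unitCoeff_spec H.f_mem.2
  rw [H.valuation_f, pow_one, mul_comm] at h
  exact ⟨_, (PadicInt.unitCoeff H.f_mem.2).isUnit, h⟩

theorem norm_coeff_one_f_lt_one (H : IsMinimalCommutingPair f u) : ‖coeff 1 f‖ < 1 := by
  obtain ⟨t, -, ht⟩ := H.exists_coeff_one_f
  rw [PadicInt.norm_lt_one_iff_dvd, ht]
  exact dvd_mul_right _ _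

theorem map_residue_f_ne_zero (H : IsMinimalCommutingPair f u) :
    map (IsLocalRing.residue ℤ_[p]) f ≠ 0 := by
  have h := H.wideg_eq
  rw [wideg] at h
  intro h0
  rw [h0, order_zero] at h
  exact ENat.natCast_ne_top p h.symm

theorem isEisensteinSeries_iterQuot (H : IsMinimalCommutingPair f u) (m : ℕ) :
    IsEisensteinSeries (iterQuot f m) := by
  obtain ⟨t, ht, hft⟩ := H.exists_coeff_one_f
  refine ⟨map_residue_iterQuot_ne_zero H.constantCoeff_f H.map_residue_f_ne_zero m, ?_, ?_⟩ <;>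
    rw [constantCoeff_iterQuot H.constantCoeff_f, hft]
  · exact dvd_mul_right _ _
  · rw [pow_two, mul_dvd_mul_iff_left PadicInt.prime_p.ne_zero]
    exact (isUnit_iff_not_dvd t).mp ht

/-- The zeros of the iterates of `f` are simple. -/
theorem eval_derivative_iter_ne_zero (H : IsMinimalCommutingPair f u) (m : ℕ) {x : PadicAlgCl p}
    (hx : ‖x‖ < 1) (h : eval (iter f m) x = 0) : eval (d⁄dX ℤ_[p] (iter f m)) x ≠ 0 := by
  induction m with
  | zero => simpa [iter] using eval_ne_zero_of_isUnit (isUnit_one (M := PowerSeries ℤ_[p])) hx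
  | succ m ih =>
    have hf := H.constantCoeff_f
    rw [iter_succ_eq_mul hf, eval_mul _ _ hx] at h
    rw [iter_succ_eq_mul hf, Derivation.leibniz, smul_eq_mul, smul_eq_mul, eval_add _ _ hx,
      eval_mul _ _ hx, eval_mul _ _ hx]
    -- At a root of `f^m` the ratio takes the value `f'(0) ≠ 0`; at any other root the ratio itself
    -- has a simple zero.
    by_cases hm : eval (iter f m) x = 0
    · rw [hm, zero_mul, zero_add]
      refine mul_ne_zero ?_ (ih hm)
      rw [iterQuot, eval_comp _ (constantCoeff_iter hf m) hx, hm, eval_zero_right,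
        constantCoeff_shift, Ne, map_eq_zero_iff _ algebraMap_padicInt_injective]
      exact H.f_mem.2
    · have hq := (mul_eq_zero.mp h).resolve_left hm
      rw [hq, zero_mul, add_zero]
      exact mul_ne_zero hm ((H.isEisensteinSeries_iterQuot m).eval_derivative_ne_zero hx hq)

theorem exists_coeff_one_iter_u (H : IsMinimalCommutingPair f u) {d : ℕ} (hd : d ≠ 0) :
    ∃ t, IsUnit t ∧
      coeff 1 (iter u d) - 1 = (p : ℤ_[p]) ^ (delta p + padicValNat p d) * t := by
  rw [coeff_one_iter H.constantCoeff_u]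
  -- `u'(0) = 1` is excluded because the valuation of `0` is `0` by convention, whereas `δ ≥ 1`.
  refine exists_pow_sub_one_eq (fun h => ?_) H.valuation_u hd
  have := H.valuation_u
  rw [h, sub_self, PadicInt.valuation_zero] at this
  exact absurd (one_le_delta p) (by omega)

theorem coeff_one_iter_u_ne_one (H : IsMinimalCommutingPair f u) {d : ℕ} (hd : d ≠ 0) :
    coeff 1 (iter u d) ≠ 1 := by
  obtain ⟨t, ht, h⟩ := H.exists_coeff_one_iter_u hd
  rw [← sub_ne_zero, h]
  exact mul_ne_zero (pow_ne_zero _ PadicInt.prime_p.ne_zero) ht.ne_zero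

theorem isUnit_coeff_one_iter_u (H : IsMinimalCommutingPair f u) (i : ℕ) :
    IsUnit (coeff 1 (iter u i)) := by
  rw [coeff_one_iter H.constantCoeff_u]
  exact H.u_invertible.2.pow i

theorem eval_iter_comm (H : IsMinimalCommutingPair f u) (m i : ℕ) {x : PadicAlgCl p}
    (hx : ‖x‖ < 1) :
    eval (iter f m) (eval (iter u i) x) = eval (iter u i) (eval (iter f m) x) :=
  eval_comm (constantCoeff_iter H.constantCoeff_f m) (constantCoeff_iter H.constantCoeff_u i)
    (iter_comp_iter_comm H.constantCoeff_f H.constantCoeff_u H.commute m i) hx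

theorem eval_iter_f_eq_zero_of_eval_iter_u (H : IsMinimalCommutingPair f u) (m i : ℕ)
    {x : PadicAlgCl p} (hx : ‖x‖ < 1) (h : eval (iter f m) (eval (iter u i) x) = 0) :
    eval (iter f m) x = 0 := by
  rw [H.eval_iter_comm m i hx] at h
  exact eq_zero_of_eval_eq_zero_of_isUnit (constantCoeff_iter H.constantCoeff_u i)
    (H.isUnit_coeff_one_iter_u i) (norm_eval_lt_one (constantCoeff_iter H.constantCoeff_f m) hx) h

theorem exists_eval_iter_eq_zero (H : IsMinimalCommutingPair f u) {d : ℕ} (hd : d ≠ 0)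
    {x : PadicAlgCl p} (hx : ‖x‖ < 1) (hfix : eval (iter u d) x = x) :
    ∃ m, eval (iter f m) x = 0 :=
  exists_eval_iter_eq_zero_of_fixed H.constantCoeff_f H.norm_coeff_one_f_lt_one
    (constantCoeff_iter H.constantCoeff_u d) (H.coeff_one_iter_u_ne_one hd)
    (comp_iter_comm H.constantCoeff_f H.constantCoeff_u H.commute d) hx hfix

/-- Differentiating `f ∘ u^i = u^i ∘ f` shows that zeros of `f'` are carried to zeros of `f'` by
`u`. They are finite in number, so some `u^i(x)` is periodic, and it and `x` are roots of an iterate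
`f^m`. Then `x` would be a multiple root of `f^(m+1)`. -/
theorem eval_derivative_f_ne_zero (H : IsMinimalCommutingPair f u) {x : PadicAlgCl p}
    (hx : ‖x‖ < 1) : eval (d⁄dX ℤ_[p] f) x ≠ 0 := by
  intro h0
  have hf := H.constantCoeff_f
  have hu := H.constantCoeff_u
  have horbit : ∀ i, eval (iter u i) x ∈
      {y : PadicAlgCl p | ‖y‖ < 1 ∧ eval (d⁄dX ℤ_[p] f) y = 0} := by
    intro i
    have hi := constantCoeff_iter hu i
    refine ⟨norm_eval_lt_one hi hx, ?_⟩
    have h1 := congrArg (fun g => eval (d⁄dX ℤ_[p] g) x) (comp_iter_comm hf hu H.commute i)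
    simp only [derivative_comp _ hi, derivative_comp _ hf, eval_mul _ _ hx, eval_comp _ hi hx,
      h0, mul_zero] at h1
    refine (mul_eq_zero.mp h1).resolve_right (eval_ne_zero_of_isUnit ?_ hx)
    rw [isUnit_iff_constantCoeff, constantCoeff_derivative]
    exact H.isUnit_coeff_one_iter_u i
  have hne : d⁄dX ℤ_[p] f ≠ 0 := by
    intro h
    have := constantCoeff_derivative f
    rw [h, map_zero] at this
    exact H.f_mem.2 this.symm
  obtain ⟨i, j, hij, hlt⟩ : ∃ i j, eval (iter u i) x = eval (iter u j) x ∧ i < j := by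
    by_contra! hcon
    refine (Set.infinite_of_injective_forall_mem (fun i j hij => ?_) horbit) (finite_zeros hne)
    exact le_antisymm (hcon j i hij.symm) (hcon i j hij)
  obtain ⟨d, rfl⟩ := Nat.exists_eq_add_of_le' hlt.le
  rw [eval_iter_add hu _ _ hx] at hij
  obtain ⟨m, hm⟩ := H.exists_eval_iter_eq_zero (d := d) (by omega)
    (norm_eval_lt_one (constantCoeff_iter hu i) hx) hij.symm
  have hm1 := H.eval_iter_f_eq_zero_of_eval_iter_u m i hx hm
  -- Passing to `m + 1` ensures that `f'(x)` occurs as a factor of the derivative, even when `m =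
  -- 0`.
  have hder := H.eval_derivative_iter_ne_zero (m + 1) hx
    (eval_iter_eq_zero_of_le hf (Nat.le_succ m) hx hm1)
  rw [iter_add hf, iter_one, derivative_comp _ hf, eval_mul _ _ hx, h0, mul_zero] at hder
  exact hder rfl

theorem C_p_dvd_derivative_f (H : IsMinimalCommutingPair f u) :
    C (p : ℤ_[p]) ∣ d⁄dX ℤ_[p] f := by
  have hne : d⁄dX ℤ_[p] f ≠ 0 := fun h =>
    H.eval_derivative_f_ne_zero (x := 0) (by simp)
      (by rw [h, eval_zero_right, map_zero, map_zero])
  obtain ⟨c, U, hU, hunit⟩ :=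
    exists_eq_p_pow_mul_unit hne fun x hx => H.eval_derivative_f_ne_zero hx
  -- An exponent `c = 0` would make `f'(0)` a unit.
  rcases Nat.eq_zero_or_pos c with rfl | hc
  · exfalso
    obtain ⟨t, -, ht⟩ := H.exists_coeff_one_f
    have h1 : IsUnit (coeff 1 f) := by
      rw [← constantCoeff_derivative, hU]
      simpa using hunit.map (constantCoeff (R := ℤ_[p]))
    exact (isUnit_iff_not_dvd _).mp h1 (ht ▸ dvd_mul_right _ _)
  · rw [hU]
    exact (map_dvd C (dvd_pow_self _ hc.ne')).mul_right _

/-- Otherwise the chain rule for `f^m ∘ u^d = u^d ∘ f^m` at `x` gives `(f^m)'(x) = (u^d)'(0) *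
(f^m)'(x)`, while `(f^m)'(x) ≠ 0` and `(u^d)'(0) ≠ 1`. -/
theorem eval_derivative_iter_u_ne_one (H : IsMinimalCommutingPair f u) {d : ℕ} (hd : d ≠ 0)
    (m : ℕ) {x : PadicAlgCl p} (hx : ‖x‖ < 1) (hm : eval (iter f m) x = 0)
    (hfix : eval (iter u d) x = x) : eval (d⁄dX ℤ_[p] (iter u d)) x ≠ 1 := by
  intro h1
  have hfm := constantCoeff_iter H.constantCoeff_f m
  have hud := constantCoeff_iter H.constantCoeff_u d
  have h := congrArg (fun g => eval (d⁄dX ℤ_[p] g) x)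
    (iter_comp_iter_comm H.constantCoeff_f H.constantCoeff_u H.commute m d)
  simp only [derivative_comp _ hfm, derivative_comp _ hud, eval_mul _ _ hx, eval_comp _ hfm hx,
    eval_comp _ hud hx, hfix, hm, h1, mul_one, eval_zero_right, constantCoeff_derivative] at h
  have h2 := mul_right_cancel₀ (H.eval_derivative_iter_ne_zero m hx hm) ((one_mul _).trans h)
  exact H.coeff_one_iter_u_ne_one hd (algebraMap_padicInt_injective (by rw [← h2, map_one]))

theorem iterQuot_dvd_of_eval (H : IsMinimalCommutingPair f u) {d : ℕ} {M : ℕ}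
    {w : PowerSeries ℤ_[p]} (hw : iter u d - X = iter f M * w) {x : PadicAlgCl p} (hx : ‖x‖ < 1)
    (hfix : eval (iter u d) x = x) {k : ℕ} (hk : eval (iter f k) x = 0)
    (hM : eval (iter f M) x ≠ 0) : iterQuot f M ∣ w := by
  have hf := H.constantCoeff_f
  classical
  have hex : ∃ k, eval (iter f k) x = 0 := ⟨k, hk⟩
  set m := Nat.find hex with hm_def
  have hm : eval (iter f m) x = 0 := Nat.find_spec hex
  have hlt : M < m := by
    by_contra! hle
    exact hM (eval_iter_eq_zero_of_le hf hle hx hm)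
  -- With `m` minimal, `y` is the point of the `f`-orbit that reaches `0` after exactly `M + 1`
  -- steps: a zero of `iterQuot f M`, still fixed by `u^d`.
  set y := eval (iter f (m - (M + 1))) x
  have hy : ‖y‖ < 1 := norm_eval_lt_one (constantCoeff_iter hf _) hx
  have hy0 : eval (iter f M) y ≠ 0 := by
    rw [← eval_iter_add hf _ _ hx]
    exact Nat.find_min hex (by omega)
  have hy1 : eval (iter f (M + 1)) y = 0 := by
    rw [← eval_iter_add hf _ _ hx, show M + 1 + (m - (M + 1)) = m by omega, hm]
  have hyfix : eval (iter u d) y = y := by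
    rw [← H.eval_iter_comm _ _ hx, hfix]
  rw [iter_succ_eq_mul hf, eval_mul _ _ hy] at hy1
  refine (H.isEisensteinSeries_iterQuot M).dvd_of_eval_eq_zero hy
    ((mul_eq_zero.mp hy1).resolve_left hy0) ?_
  have := congrArg (fun g => eval g y) hw
  simp only [eval_sub _ _ hy, eval_mul _ _ hy, eval_X, hyfix, sub_self] at this
  exact (mul_eq_zero.mp this.symm).resolve_left hy0

/-- `u^d - X` is a unit multiple of an iterate of `f`. -/
theorem exists_iter_u_sub_X_eq (H : IsMinimalCommutingPair f u) {d : ℕ} (hd : d ≠ 0) :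
    ∃ U, IsUnit U ∧ iter u d - X = iter f (delta p + padicValNat p d) * U := by
  have hf := H.constantCoeff_f
  have hu := constantCoeff_iter H.constantCoeff_u d
  obtain ⟨t, ht, hcoeff⟩ := H.exists_coeff_one_iter_u hd
  obtain ⟨s, hs, hfs⟩ := H.exists_coeff_one_f
  set v := delta p + padicValNat p d
  -- Comparing linear coefficients bounds `M` by `v`, so a maximal `M` exists; it will force `M = v`
  -- once `w` is a unit.
  have hcoeff' : ∀ {M w}, iter u d - X = iter f M * w →
      (p : ℤ_[p]) ^ v * t = (p : ℤ_[p]) ^ M * (s ^ M * constantCoeff w) := by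
    intro M w h
    have h1 := congrArg (coeff 1) h
    rw [map_sub, coeff_one_X, hcoeff, coeff_one_mul, coeff_one_iter hf,
      constantCoeff_iter hf, hfs] at h1
    rw [h1]
    ring
  have hbound : ∀ M, iter f M ∣ iter u d - X → M ≤ v := by
    rintro M ⟨w, hw⟩
    have h1 : (p : ℤ_[p]) ^ M ∣ p ^ v := by
      rw [← ht.dvd_mul_right, hcoeff' hw]
      exact dvd_mul_right _ _
    exact (pow_dvd_pow_iff PadicInt.prime_p.ne_zero PadicInt.prime_p.not_isUnit).mp h1
  classical
  have h0 : iter f 0 ∣ iter u d - X :=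
    X_dvd_iff.mpr (by rw [map_sub, hu, constantCoeff_X, sub_zero])
  set M := Nat.findGreatest (fun M => iter f M ∣ iter u d - X) v
  obtain ⟨w, hw⟩ : iter f M ∣ iter u d - X :=
    Nat.findGreatest_spec (P := fun M => iter f M ∣ iter u d - X) (Nat.zero_le v) h0
  have hmax : ¬ iter f (M + 1) ∣ iter u d - X := fun h =>
    (Nat.lt_succ_self M).not_ge
      (Nat.le_findGreatest (P := fun M => iter f M ∣ iter u d - X) (hbound _ h) h)
  have hw0 : w ≠ 0 := by
    rintro rfl
    have := hcoeff' hw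
    simp [ht.ne_zero, PadicInt.prime_p.ne_zero] at this
  have hroot : ∀ x : PadicAlgCl p, ‖x‖ < 1 → eval w x ≠ 0 := by
    intro x hx hwx
    have hfix : eval (iter u d) x = x := by
      have := congrArg (fun g => eval g x) hw
      simp only [eval_sub _ _ hx, eval_mul _ _ hx, eval_X, hwx, mul_zero] at this
      exact sub_eq_zero.mp this
    -- A common zero of `f^M` and `w` is a double zero of `u^d - X`; any other zero of `w` would let
    -- `M` grow.
    by_cases hM : eval (iter f M) x = 0
    · refine H.eval_derivative_iter_u_ne_one hd M hx hM hfix ?_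
      have := congrArg (fun g => eval (d⁄dX ℤ_[p] g) x) hw
      simp only [map_sub, Derivation.leibniz, smul_eq_mul, eval_sub _ _ hx, eval_add _ _ hx,
        eval_mul _ _ hx, hM, hwx, zero_mul, add_zero, derivative_X] at this
      rw [sub_eq_zero.mp this]
      exact map_one (evalHom x hx)
    · obtain ⟨k, hk⟩ := H.exists_eval_iter_eq_zero hd hx hfix
      obtain ⟨w', hw'⟩ := H.iterQuot_dvd_of_eval hw hx hfix hk hM
      exact hmax ⟨w', by rw [hw, hw', iter_succ_eq_mul hf, mul_assoc]⟩
  obtain ⟨c, U, hcU, hU⟩ := exists_eq_p_pow_mul_unit hw0 hroot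
  have hc : c = 0 := by
    by_contra hc
    have hX : iter u d = X + C ((p : ℤ_[p]) ^ c) * (iter f M * U) := by
      rw [eq_add_of_sub_eq' hw, hcU]
      ring
    -- If `c ≥ 1`, then `p` divides `f^M * U`; but `U` is a unit and the reduction of `f^M` is
    -- nonzero.
    have hdvd := C_p_dvd_of_commute (h := iter f M * U) (Nat.one_le_iff_ne_zero.mpr hc) hf
      H.map_residue_f_ne_zero H.C_p_dvd_derivative_f
      (by rw [map_mul, constantCoeff_iter hf, zero_mul])
      (hX ▸ comp_iter_comm hf H.constantCoeff_u H.commute d)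
    rw [hU.dvd_mul_right, ← map_residue_eq_zero_iff, map_iter _ hf] at hdvd
    refine iter_ne_zero ?_ H.map_residue_f_ne_zero M hdvd
    rw [← coeff_zero_eq_constantCoeff_apply, coeff_map, coeff_zero_eq_constantCoeff_apply, hf,
      map_zero]
  subst hc
  rw [pow_zero, map_one, one_mul] at hcU
  subst hcU
  have hMv : M = v := by
    refine le_antisymm (hbound M ⟨w, hw⟩) ?_
    have h1 : (p : ℤ_[p]) ^ v ∣ p ^ M := by
      rw [← ((hs.pow M).mul (hU.map (constantCoeff (R := ℤ_[p])))).dvd_mul_right, ← hcoeff' hw]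
      exact dvd_mul_right _ _
    exact (pow_dvd_pow_iff PadicInt.prime_p.ne_zero PadicInt.prime_p.not_isUnit).mp h1
  exact ⟨w, hU, hMv ▸ hw⟩

/-- The fixed points of `u^d` are the zeros of an iterate of `f`. -/
theorem eval_iter_u_eq_self_iff (H : IsMinimalCommutingPair f u) {d : ℕ} (hd : d ≠ 0)
    {x : PadicAlgCl p} (hx : ‖x‖ < 1) :
    eval (iter u d) x = x ↔ eval (iter f (delta p + padicValNat p d)) x = 0 := by
  obtain ⟨U, hU, h⟩ := H.exists_iter_u_sub_X_eq hd
  have := congrArg (fun g => eval g x) h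
  simp only [eval_sub _ _ hx, eval_mul _ _ hx, eval_X] at this
  rw [← sub_eq_zero, this, mul_eq_zero, or_iff_left (eval_ne_zero_of_isUnit hU hx)]

/-- The point `u^i(x)` is fixed by `u^d` exactly when it is a root of `f^(δ + v_p(d))`. Since `u^i`
commutes with `f` and vanishes only at `0`, this means that `x` is such a root, that is, `n + 1 ≤ δ
+ v_p(d)`. -/
theorem eval_iter_u_add_eq_iff (H : IsMinimalCommutingPair f u) {n : ℕ} (hn : delta p ≤ n)
    {x : PadicAlgCl p} (hx : x ∈ newRootSet f (n + 1)) (i d : ℕ) :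
    eval (iter u (d + i)) x = eval (iter u i) x ↔ p ^ (n - delta p + 1) ∣ d := by
  have hf := H.constantCoeff_f
  have hu := H.constantCoeff_u
  obtain ⟨⟨hx1, hxn⟩, hxn'⟩ := hx
  have hx1 : ‖x‖ < 1 := hx1
  have hxn' : eval (iter f n) x ≠ 0 := fun h => hxn' ⟨hx1, h⟩
  -- The case `d = 0` is separate because `padicValNat p 0 = 0` by convention.
  rcases eq_or_ne d 0 with rfl | hd
  · simp
  have hzero : ∀ m, eval (iter f m) x = 0 ↔ n + 1 ≤ m := by
    refine fun m => ⟨fun h => ?_, fun h => eval_iter_eq_zero_of_le hf h hx1 hxn⟩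
    by_contra! hlt
    exact hxn' (eval_iter_eq_zero_of_le hf (Nat.lt_succ_iff.mp hlt) hx1 h)
  have hui : ‖eval (iter u i) x‖ < 1 := norm_eval_lt_one (constantCoeff_iter hu i) hx1
  rw [eval_iter_add hu _ _ hx1, H.eval_iter_u_eq_self_iff hd hui,
    padicValNat_dvd_iff_le hd]
  constructor
  · intro h
    have := (hzero _).mp (H.eval_iter_f_eq_zero_of_eval_iter_u _ _ hx1 h)
    omega
  · intro h
    rw [H.eval_iter_comm _ _ hx1, (hzero _).mpr (by omega),
      eval_zero_eq_zero (constantCoeff_iter hu i)]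

end IsMinimalCommutingPair

end PadicDyn

theorem mainTheorem4 (p : ℕ) [Fact p.Prime] (f u : PowerSeries ℤ_[p])
    (hfu : PadicDyn.IsMinimalCommutingPair f u) (n : ℕ) (hn : PadicDyn.delta p ≤ n) :
    (∀ π ∈ PadicDyn.newRootSet f (n + 1), ∀ i j : ℕ,
      PadicDyn.eval (PadicDyn.iter u i) π = PadicDyn.eval (PadicDyn.iter u j) π ↔
        (p : ℤ) ^ (n - PadicDyn.delta p + 1) ∣ (j : ℤ) - (i : ℤ)) ∧
    PadicDyn.rootSet f n = PadicDyn.fixedSet u (n - PadicDyn.delta p) := by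
  constructor
  · intro π hπ i j
    rcases le_total i j with hij | hij
    · obtain ⟨d, rfl⟩ := Nat.exists_eq_add_of_le' hij
      rw [eq_comm, hfu.eval_iter_u_add_eq_iff hn hπ i d, Nat.cast_add, add_sub_cancel_right]
      norm_cast
    · obtain ⟨d, rfl⟩ := Nat.exists_eq_add_of_le' hij
      rw [hfu.eval_iter_u_add_eq_iff hn hπ j d, Nat.cast_add, dvd_sub_comm,
        add_sub_cancel_right]
      norm_cast
  · ext x
    refine and_congr_right fun hx => ?_
    have hp : p.Prime := Fact.out
    rw [hfu.eval_iter_u_eq_self_iff (pow_ne_zero _ hp.ne_zero) hx, padicValNat.prime_pow,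
      Nat.add_sub_cancel' hn]
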